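/- Let $G$ be a group, let $\phi\colon G\to\mathbb Z$ be an epimorphism with kernel $K$, and let $t\in G$ be an element such that $\phi(t)$ generates $\mathbb Z$. Let $\mathcal N K$ be the group von Neumann algebra of $K$, that is, the algebra of bounded operators on $\ell^2 K$ that commute with the right action of $K$; conjugation by $t$ on $K$ induces an automorphism $T\mapsto tTt^{-1}$ of $\mathcal N K$. Let $\mathcal N K[t^{\pm1}]$ be the ring of Laurent polynomials in $t$ with coefficients in $\mathcal N K$, with multiplication twisted by this automorphism: $tT=(tTt^{-1})\,t$ for $T\in\mathcal N K$. Every $x\in\mathcal N K[t^{\pm1}]$ can be written uniquely as a finite sum $x=\sum_i t^i x_i$ with $x_i\in\mathcal N K$. The pure part of the initial term of $x$ is $x_k$, where $k$ is the least integer with $x_k\ne0$, if $x\neq 0$, and it is $0$ if $x=0$. The nullity $\operatorname{nul}x$ is the $\mathcal N K$-dimension of the kernel in $\ell^2K$ of this pure part, that is, the von Neumann trace $\langle \pi\delta_1,\delta_1\rangle$ of the orthogonal projection $\pi$ onto that kernel. Approximate Ore condition: for all $q,q'\in\mathcal N K[t^{\pm1}]$ and every $\varepsilon>0$ there exist $r,r'\in\mathcal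 N K[t^{\pm1}]$ such that $$\operatorname{nul}r<\operatorname{nul}q'+\varepsilon,\qquad \operatorname{nul}r'<\operatorname{nul}q+\operatorname{nul}q'+\varepsilon,\qquad qr=q'r'.$$ -/

import Mathlib

noncomputable section

/-- The Hilbert space `ℓ²(α)` of square summable complex functions on `α`. -/
abbrev EllTwo (α : Type*) : Type _ := lp (fun _ : α => ℂ) 2

namespace EllTwo

theorem memlp_comp {α β : Type*} (e : α ≃ β) (f : EllTwo β) :
    Memℓp (E := fun _ : α => ℂ) (fun a => f (e a)) 2 := by
  have h := (memℓp_gen_iff (E := fun _ : β => ℂ) (p := 2) (by norm_num)).1 (lp.memℓp f)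
  exact (memℓp_gen_iff (E := fun _ : α => ℂ) (p := 2) (by norm_num)).2 (e.summable_iff.2 h)

/-- The unitary operator `ℓ²(β) → ℓ²(α)`, `f ↦ f ∘ e`, given by a bijection `e : α ≃ β`. -/
def reindex {α β : Type*} (e : α ≃ β) : EllTwo β ≃ₗᵢ[ℂ] EllTwo α where
  toFun f := ⟨fun a => f (e a), memlp_comp e f⟩
  invFun f := ⟨fun b => f (e.symm b), memlp_comp e.symm f⟩
  map_add' _ _ := rfl
  map_smul' _ _ := rfl
  left_inv f := by ext b; exact congrArg f (e.apply_symm_apply b)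
  right_inv f := by ext a; exact congrArg f (e.symm_apply_apply a)
  norm_map' f := by
    have h2 : 0 < (2 : ENNReal).toReal := by norm_num
    rw [lp.norm_eq_tsum_rpow h2, lp.norm_eq_tsum_rpow h2]
    congr 1
    exact e.tsum_eq (fun b => ‖f b‖ ^ (2 : ENNReal).toReal)

@[simp] theorem reindex_apply {α β : Type*} (e : α ≃ β) (f : EllTwo β) (a : α) :
    reindex e f a = f (e a) := rfl

@[simp] theorem reindex_symm {α β : Type*} (e : α ≃ β) :
    (reindex e).symm = reindex e.symm := rfl

/-- The right action of `g` on `ℓ²(Γ)`: on formal sums, `∑ λ_x x ↦ ∑ λ_x (x g)`. -/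
def rightMul {Γ : Type*} [Group Γ] (g : Γ) : EllTwo Γ ≃ₗᵢ[ℂ] EllTwo Γ :=
  reindex (Equiv.mulRight g⁻¹)

@[simp] theorem rightMul_apply {Γ : Type*} [Group Γ] (g : Γ) (f : EllTwo Γ) (x : Γ) :
    rightMul g f x = f (x * g⁻¹) := rfl

/-- The unitary operator on `ℓ²(Γ)` induced by an automorphism `σ` of `Γ`:
on formal sums, `∑ λ_x x ↦ ∑ λ_x σ(x)`. -/
def autMap {Γ : Type*} [Group Γ] (σ : MulAut Γ) : EllTwo Γ ≃ₗᵢ[ℂ] EllTwo Γ :=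
  reindex (σ⁻¹).toEquiv

@[simp] theorem autMap_apply {Γ : Type*} [Group Γ] (σ : MulAut Γ) (f : EllTwo Γ) (x : Γ) :
    autMap σ f x = f (σ⁻¹ x) := rfl

end EllTwo

/-- The group von Neumann algebra `𝒩Γ`: the bounded operators on `ℓ²(Γ)` that commute with the
right action of `Γ`. -/
def groupVN (Γ : Type*) [Group Γ] : StarSubalgebra ℂ (EllTwo Γ →L[ℂ] EllTwo Γ) where
  carrier := {T | ∀ (g : Γ) (f : EllTwo Γ), T (EllTwo.rightMul g f) = EllTwo.rightMul g (T f)}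
  mul_mem' {S T} hS hT g f := by
    simp only [mul_apply_eq_comp, hT g f, hS g (T f)]
  add_mem' {S T} hS hT g f := by
    simp only [add_apply, hS g f, hT g f, map_add]
  algebraMap_mem' c g f := by
    simp [Algebra.algebraMap_eq_smul_one]
  star_mem' {T} hT g f := by
    refine ext_inner_right ℂ fun h => ?_
    have key : ∀ u v : EllTwo Γ, inner ℂ (EllTwo.rightMul g u) v
        = inner ℂ u (EllTwo.rightMul g⁻¹ v) := by
      intro u v
      rw [← (EllTwo.rightMul g).inner_map_map u (EllTwo.rightMul g⁻¹ v)]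
      congr 1
      ext x
      simp
    rw [ContinuousLinearMap.star_eq_adjoint, ContinuousLinearMap.adjoint_inner_left, key, key,
      ContinuousLinearMap.adjoint_inner_left, hT]

theorem mem_groupVN {Γ : Type*} [Group Γ] {T : EllTwo Γ →L[ℂ] EllTwo Γ} :
    T ∈ groupVN Γ ↔
      ∀ (g : Γ) (f : EllTwo Γ), T (EllTwo.rightMul g f) = EllTwo.rightMul g (T f) :=
  Iff.rfl

/-- The von Neumann trace `tr T = ⟨T δ₁, δ₁⟩` (Mathlib's inner product is linear in the second
variable). -/
def vnTrace {Γ : Type*} [Group Γ] (T : EllTwo Γ →L[ℂ] EllTwo Γ) : ℂ :=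
  letI := Classical.decEq Γ
  inner ℂ (lp.single (E := fun _ : Γ => ℂ) 2 (1 : Γ) (1 : ℂ))
    (T (lp.single (E := fun _ : Γ => ℂ) 2 (1 : Γ) (1 : ℂ)))

/-- The von Neumann dimension of a closed (right `Γ`-invariant) subspace of `ℓ²(Γ)`: the von
Neumann trace of the orthogonal projection onto it (a real number). -/
def vnDim {Γ : Type*} [Group Γ] (V : Submodule ℂ (EllTwo Γ)) [V.HasOrthogonalProjection] : ℝ :=
  (vnTrace V.starProjection).re

/-- The `𝒩Γ`-dimension of the kernel of `T ∈ 𝒩Γ`. -/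
def dimKer {Γ : Type*} [Group Γ] (T : groupVN Γ) : ℝ :=
  vnDim (T : EllTwo Γ →L[ℂ] EllTwo Γ).ker

theorem conj_autMap_mem {Γ : Type*} [Group Γ] (σ : MulAut Γ) {T : EllTwo Γ →L[ℂ] EllTwo Γ}
    (hT : T ∈ groupVN Γ) :
    (EllTwo.autMap σ).toContinuousLinearEquiv.conjContinuousAlgEquiv T ∈ groupVN Γ := by
  intro g f
  have h1 : ∀ f : EllTwo Γ, (EllTwo.autMap σ).symm (EllTwo.rightMul g f)
      = EllTwo.rightMul (σ⁻¹ g) ((EllTwo.autMap σ).symm f) := by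
    intro f
    ext x
    change f (σ x * g⁻¹) = f (σ (x * (σ⁻¹ g)⁻¹))
    simp
  have h2 : ∀ f : EllTwo Γ, EllTwo.autMap σ (EllTwo.rightMul (σ⁻¹ g) f)
      = EllTwo.rightMul g (EllTwo.autMap σ f) := by
    intro f
    ext x
    simp
  change EllTwo.autMap σ (T ((EllTwo.autMap σ).symm (EllTwo.rightMul g f)))
      = EllTwo.rightMul g (EllTwo.autMap σ (T ((EllTwo.autMap σ).symm f)))
  rw [h1, mem_groupVN.1 hT, h2]

/-- The action of `Aut Γ` on `𝒩Γ` by ring automorphisms: `σ` sends `T` to `u T u⁻¹`, where `u` is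
the unitary operator induced by `σ`. On `ℂΓ ⊆ 𝒩Γ` (acting from the left) this is the linear
extension of `σ`. -/
def groupVNAut (Γ : Type*) [Group Γ] : MulAut Γ →* RingAut (groupVN Γ) where
  toFun σ :=
    { toFun := fun T => ⟨_, conj_autMap_mem σ T.2⟩
      invFun := fun T => ⟨_, conj_autMap_mem σ⁻¹ T.2⟩
      left_inv := fun T => by
        refine Subtype.ext (ContinuousLinearMap.ext fun f => ?_)
        have h : ∀ f : EllTwo Γ, EllTwo.autMap σ⁻¹ (EllTwo.autMap σ f) = f := fun f => by
          ext x; simp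
        have h' : ∀ f : EllTwo Γ,
            (EllTwo.autMap σ).symm ((EllTwo.autMap σ⁻¹).symm f) = f := fun f => by
          ext x
          change f (σ⁻¹ (σ x)) = f x
          simp
        change EllTwo.autMap σ⁻¹ (EllTwo.autMap σ ((T : EllTwo Γ →L[ℂ] EllTwo Γ)
          ((EllTwo.autMap σ).symm ((EllTwo.autMap σ⁻¹).symm f)))) = _
        rw [h, h']
      right_inv := fun T => by
        refine Subtype.ext (ContinuousLinearMap.ext fun f => ?_)
        have h : ∀ f : EllTwo Γ, EllTwo.autMap σ (EllTwo.autMap σ⁻¹ f) = f := fun f => by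
          ext x; simp
        have h' : ∀ f : EllTwo Γ,
            (EllTwo.autMap σ⁻¹).symm ((EllTwo.autMap σ).symm f) = f := fun f => by
          ext x
          change f (σ (σ⁻¹ x)) = f x
          simp
        change EllTwo.autMap σ (EllTwo.autMap σ⁻¹ ((T : EllTwo Γ →L[ℂ] EllTwo Γ)
          ((EllTwo.autMap σ⁻¹).symm ((EllTwo.autMap σ).symm f)))) = _
        rw [h, h']
      map_mul' := fun S T => Subtype.ext (map_mul _ _ _)
      map_add' := fun S T => Subtype.ext (map_add _ _ _) }
  map_one' := rfl
  map_mul' _ _ := rfl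

/-- The ring `R[t^{±1}]` of twisted Laurent polynomials over `R` with respect to
`ν : ℤ → Aut(R)`: finite sums `∑ a_n t^n` with `(a t^m) (b t^n) = a ν(m)(b) t^(m+n)`. -/
def TwistedLaurent (R : Type*) [Ring R] (_ν : Multiplicative ℤ →* RingAut R) : Type _ :=
  SkewMonoidAlgebra R (Multiplicative ℤ)

namespace TwistedLaurent

variable {R : Type*} [Ring R] {ν : Multiplicative ℤ →* RingAut R}

instance instRing : Ring (TwistedLaurent R ν) :=
  letI : MulSemiringAction (Multiplicative ℤ) R := MulSemiringAction.compHom R ν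
  inferInstanceAs (Ring (SkewMonoidAlgebra R (Multiplicative ℤ)))

/-- The monomial `a t^n`. -/
def monomial (n : ℤ) (a : R) : TwistedLaurent R ν :=
  SkewMonoidAlgebra.single (Multiplicative.ofAdd n) a

theorem monomial_mul_monomial (m n : ℤ) (a b : R) :
    (monomial m a * monomial n b : TwistedLaurent R ν) =
      monomial (m + n) (a * ν (Multiplicative.ofAdd m) b) :=
  letI : MulSemiringAction (Multiplicative ℤ) R := MulSemiringAction.compHom R ν
  SkewMonoidAlgebra.single_mul_single

/-- The coefficients `a_n` of `x = ∑ a_n t^n`. -/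
def coeff (x : TwistedLaurent R ν) (n : ℤ) : R :=
  SkewMonoidAlgebra.coeff (k := R) (G := Multiplicative ℤ) x (Multiplicative.ofAdd n)

/-- The set of `n` with `a_n ≠ 0`, for `x = ∑ a_n t^n`. -/
def support (x : TwistedLaurent R ν) : Finset ℤ :=
  (SkewMonoidAlgebra.support (k := R) (G := Multiplicative ℤ) x).map
    Multiplicative.toAdd.toEmbedding

theorem mem_support (x : TwistedLaurent R ν) (n : ℤ) : n ∈ x.support ↔ x.coeff n ≠ 0 := by
  rw [support, Finset.mem_map_equiv]
  exact SkewMonoidAlgebra.mem_support_iff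

/-- The coefficients `x_n` of `x` when it is written as `x = ∑ t^n x_n`, with the powers of `t` on
the left. As `t^n x_n = ν(n)(x_n) t^n`, we have `x_n = ν(-n)(a_n)` if `x = ∑ a_n t^n`. -/
def leftCoeff (x : TwistedLaurent R ν) (n : ℤ) : R :=
  ν (Multiplicative.ofAdd (-n)) (x.coeff n)

theorem eq_sum_leftCoeff (x : TwistedLaurent R ν) :
    x = ∑ n ∈ x.support, monomial n 1 * monomial 0 (x.leftCoeff n) := by
  have h : ∀ n : ℤ, (monomial n 1 * monomial 0 (x.leftCoeff n) : TwistedLaurent R ν)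
      = monomial n (x.coeff n) := by
    intro n
    have hν : ∀ y : R, ν (Multiplicative.ofAdd n) (ν (Multiplicative.ofAdd (-n)) y) = y := by
      intro y
      rw [← RingAut.mul_apply, ← map_mul, ← ofAdd_add]
      simp
    rw [monomial_mul_monomial, leftCoeff, hν, add_zero, one_mul]
  simp only [h, support, Finset.sum_map]
  exact (SkewMonoidAlgebra.sum_single (k := R) (G := Multiplicative ℤ) x).symm

/-- The power `k` associated to the initial term `t^k x_k` of `x = ∑ t^n x_n`: the least `k` with
`x_k ≠ 0`, and `0` if `x = 0`. -/
def initPower (x : TwistedLaurent R ν) : ℤ :=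
  if h : x.support.Nonempty then x.support.min' h else 0

/-- The pure part `x_k` of the initial term `t^k x_k` of `x = ∑ t^n x_n` (it is `0` if `x = 0`). -/
def initPure (x : TwistedLaurent R ν) : R :=
  x.leftCoeff x.initPower

end TwistedLaurent

/-- The twisting given by `t` for a normal subgroup `K` of `G` and `t : G`: the integer `n` acts on
`𝒩K` by conjugation by `t^n`. -/
def conjTwist {G : Type*} [Group G] (K : Subgroup G) [K.Normal] (t : G) :
    Multiplicative ℤ →* RingAut (groupVN K) :=
  ((groupVNAut K).comp MulAut.conjNormal).comp (zpowersHom G t)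

/-- The ring `𝒩K[t^{±1}]`, where `t` acts on `𝒩K` by conjugation. -/
abbrev VNLaurent {G : Type*} [Group G] (K : Subgroup G) [K.Normal] (t : G) : Type _ :=
  TwistedLaurent (groupVN K) (conjTwist K t)

/-- The nullity of `x`: the `𝒩K`-dimension of the kernel of the pure part of its initial term. -/
def nul {G : Type*} [Group G] {K : Subgroup G} [K.Normal] {t : G} (x : VNLaurent K t) : ℝ :=
  dimKer x.initPure

end

noncomputable section

open Filter Topology ContinuousLinearMap
open scoped InnerProduct

set_option linter.unusedSectionVars false

/-! ### Trace and von Neumann dimension over one copy of `ℓ²(Γ)`. -/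

section GroupVN

/-! Let `k`, `k'` be the initial powers of `q`, `q'`. One looks for `r = t^(-k) ∑ t^j R_j` and `r' =
t^(-k') ∑ t^j R'_j` with `0 ≤ j < m`. Then `q r = q' r'` is a system of `m + d` linear equations
over `𝒩K` in `2m` unknowns, with `d` independent of `m`. The matrices `A`, `A'` on its two sides are
lower triangular, and their diagonal entries have kernels of dimension `nul q` and `nul q'`.

The solutions in `ℓ²(K)^(2m)` form a closed invariant subspace of dimension at least `m - d`. Let
`W_i` be the solutions with vanishing coordinates `R_j`, `R'_j` for `j < i`. Imposing `R_i = 0` on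
`W_i` lowers the dimension by `1 - dim ker P_i`, where `P_i` is the diagonal entry at `R_i` of the
projection onto `W_i`. Equation `i` then reads `A'_ii R'_i = 0`, so imposing `R'_i = 0` costs at
most `nul q'`. Since `W_m = 0`, for `m ε > d` some `P_i` has a kernel of dimension less than `nul q'
+ ε`. The column of the projection through `P_i` has entries in `𝒩K` and is the solution sought
(`exists_solution_triangular`). Row `i` of the system gives `A_ii R_i = A'_ii R'_i`, which bounds
the nullity of `r'` by `dimKer_mul_le`.

The dimension counts rest on rank-nullity (`IsFrame.frameDim_ker`), which follows from the trace
property and the mean ergodic theorem. -/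

theorem re_inner_starProjection_self {E : Type*} [NormedAddCommGroup E] [InnerProductSpace ℂ E]
    (V : Submodule ℂ E) [V.HasOrthogonalProjection] (x : E) :
    (inner ℂ x (V.starProjection x)).re = ‖V.starProjection x‖ ^ 2 := by
  have h := V.re_inner_starProjection_eq_normSq x
  rw [V.inner_starProjection_left_eq_right] at h
  exact h

variable {Γ : Type*}

/-- The basis vector `δ_g` of `ℓ²(Γ)`. -/
def EllTwo.delta (g : Γ) : EllTwo Γ :=
  letI := Classical.decEq Γ
  lp.single (E := fun _ : Γ => ℂ) 2 g (1 : ℂ)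

theorem EllTwo.inner_delta (g : Γ) (f : EllTwo Γ) : inner ℂ (EllTwo.delta g) f = f g := by
  classical
  rw [EllTwo.delta, lp.inner_single_left]
  simp

theorem EllTwo.delta_apply (g x : Γ) [Decidable (x = g)] :
    EllTwo.delta g x = if x = g then 1 else 0 := by
  classical
  rw [EllTwo.delta, lp.single_apply, Pi.single_apply]
  congr

theorem EllTwo.norm_delta (g : Γ) : ‖EllTwo.delta g‖ = 1 := by
  classical
  rw [EllTwo.delta, lp.norm_single (by norm_num)]
  simp

variable [Group Γ]

theorem EllTwo.rightMul_delta_one (g : Γ) : EllTwo.rightMul g (EllTwo.delta 1) = EllTwo.delta g := by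
  classical
  ext x
  simp only [EllTwo.rightMul_apply, EllTwo.delta_apply, mul_inv_eq_one]

theorem EllTwo.autMap_delta_one (σ : MulAut Γ) :
    EllTwo.autMap σ (EllTwo.delta 1) = EllTwo.delta 1 := by
  classical
  ext x
  simp only [EllTwo.autMap_apply, EllTwo.delta_apply]
  simp

theorem vnTrace_eq (T : EllTwo Γ →L[ℂ] EllTwo Γ) :
    vnTrace T = inner ℂ (EllTwo.delta 1) (T (EllTwo.delta 1)) := rfl

theorem adjoint_mem_groupVN {T : EllTwo Γ →L[ℂ] EllTwo Γ} (hT : T ∈ groupVN Γ) :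
    T† ∈ groupVN Γ :=
  star_mem hT

theorem comp_mem_groupVN {S T : EllTwo Γ →L[ℂ] EllTwo Γ} (hS : S ∈ groupVN Γ)
    (hT : T ∈ groupVN Γ) : S ∘L T ∈ groupVN Γ :=
  mul_mem hS hT

theorem adjoint_delta_apply {a : EllTwo Γ →L[ℂ] EllTwo Γ} (ha : a ∈ groupVN Γ) (g : Γ) :
    (a†) (EllTwo.delta 1) g = star (a (EllTwo.delta 1) g⁻¹) := by
  rw [← EllTwo.inner_delta, adjoint_inner_right, ← inner_conj_symm, EllTwo.inner_delta,
    ← EllTwo.rightMul_delta_one, mem_groupVN.1 ha, EllTwo.rightMul_apply, one_mul]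
  rfl

/-- The operators act as convolutions by `a δ₁` and `b δ₁`, so the trace of `ab` is `∑ (a δ₁)(g⁻¹)
(b δ₁)(g)`; the substitution `g ↦ g⁻¹` exchanges `a` and `b`. -/
theorem vnTrace_mul_comm {a b : EllTwo Γ →L[ℂ] EllTwo Γ} (ha : a ∈ groupVN Γ)
    (hb : b ∈ groupVN Γ) : vnTrace (a ∘L b) = vnTrace (b ∘L a) := by
  have key : ∀ {a b : EllTwo Γ →L[ℂ] EllTwo Γ}, a ∈ groupVN Γ → vnTrace (a ∘L b)
      = ∑' g : Γ, a (EllTwo.delta 1) g⁻¹ * b (EllTwo.delta 1) g := by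
    intro a b ha
    rw [vnTrace_eq, comp_apply, ← adjoint_inner_left, lp.inner_eq_tsum]
    refine tsum_congr fun g => ?_
    rw [adjoint_delta_apply ha, RCLike.inner_apply]
    simp [mul_comm]
  rw [key ha, key hb, ← (Equiv.inv Γ).tsum_eq]
  refine tsum_congr fun g => ?_
  simp [mul_comm]

theorem mem_groupVN_of_tendsto {T : ℕ → EllTwo Γ →L[ℂ] EllTwo Γ} {S : EllTwo Γ →L[ℂ] EllTwo Γ}
    (hT : ∀ n, T n ∈ groupVN Γ) (h : ∀ x, Tendsto (fun n => T n x) atTop (𝓝 (S x))) :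
    S ∈ groupVN Γ := by
  intro g f
  refine tendsto_nhds_unique (h _) ?_
  simp only [mem_groupVN.1 (hT _)]
  exact ((EllTwo.rightMul g).continuous.tendsto _).comp (h f)

theorem vnDim_eq_norm_sq (V : Submodule ℂ (EllTwo Γ)) [V.HasOrthogonalProjection] :
    vnDim V = ‖V.starProjection (EllTwo.delta 1)‖ ^ 2 := by
  rw [vnDim, vnTrace_eq, re_inner_starProjection_self]

theorem norm_starProjection_apply_mono {E : Type*} [NormedAddCommGroup E] [InnerProductSpace ℂ E]
    {V W : Submodule ℂ E} [V.HasOrthogonalProjection] [W.HasOrthogonalProjection]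
    (h : V ≤ W) (x : E) : ‖V.starProjection x‖ ≤ ‖W.starProjection x‖ := by
  rw [← Submodule.starProjection_comp_starProjection_of_le h, comp_apply]
  exact V.norm_starProjection_apply_le _

theorem vnDim_mono {V W : Submodule ℂ (EllTwo Γ)} [V.HasOrthogonalProjection]
    [W.HasOrthogonalProjection] (h : V ≤ W) : vnDim V ≤ vnDim W := by
  rw [vnDim_eq_norm_sq, vnDim_eq_norm_sq]
  gcongr
  exact norm_starProjection_apply_mono h _

theorem vnDim_top : vnDim (⊤ : Submodule ℂ (EllTwo Γ)) = 1 := by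
  rw [vnDim_eq_norm_sq, Submodule.starProjection_top, coe_id', id, EllTwo.norm_delta, one_pow]

theorem vnDim_orthogonal (V : Submodule ℂ (EllTwo Γ)) [V.HasOrthogonalProjection] :
    vnDim Vᗮ = 1 - vnDim V := by
  have := V.norm_sq_eq_add_norm_sq_starProjection (EllTwo.delta 1)
  rw [vnDim_eq_norm_sq, vnDim_eq_norm_sq]
  rw [EllTwo.norm_delta] at this
  linarith

theorem dimKer_mono {S T : groupVN Γ}
    (h : (S : EllTwo Γ →L[ℂ] EllTwo Γ).ker ≤ (T : EllTwo Γ →L[ℂ] EllTwo Γ).ker) :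
    dimKer S ≤ dimKer T :=
  vnDim_mono h

theorem dimKer_zero : dimKer (0 : groupVN Γ) = 1 := by
  rw [← vnDim_top (Γ := Γ), dimKer]
  congr 1
  ext; simp

theorem dimKer_le_one (T : groupVN Γ) : dimKer T ≤ 1 :=
  (vnDim_mono le_top).trans_eq vnDim_top

/-- The unitary of `σ` carries one kernel onto the other and fixes `δ₁`. -/
theorem dimKer_groupVNAut (σ : MulAut Γ) (T : groupVN Γ) :
    dimKer (groupVNAut Γ σ T) = dimKer T := by
  have hker : ((groupVNAut Γ σ T : groupVN Γ) : EllTwo Γ →L[ℂ] EllTwo Γ).ker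
      = (T : EllTwo Γ →L[ℂ] EllTwo Γ).ker.map
        ((EllTwo.autMap σ).toLinearEquiv : EllTwo Γ →ₗ[ℂ] EllTwo Γ) := by
    ext x
    have hx : ((groupVNAut Γ σ T : groupVN Γ) : EllTwo Γ →L[ℂ] EllTwo Γ) x
      = EllTwo.autMap σ ((T : EllTwo Γ →L[ℂ] EllTwo Γ) ((EllTwo.autMap σ).symm x)) := rfl
    rw [Submodule.mem_map]
    simp only [LinearMap.mem_ker, coe_coe, hx]
    constructor
    · intro h
      exact ⟨(EllTwo.autMap σ).symm x, by simpa using h, by simp⟩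
    · rintro ⟨y, hy, rfl⟩
      simpa using hy
  have h2 : dimKer (groupVNAut Γ σ T) = vnDim ((T : EllTwo Γ →L[ℂ] EllTwo Γ).ker.map
        ((EllTwo.autMap σ).toLinearEquiv : EllTwo Γ →ₗ[ℂ] EllTwo Γ)) := by
    rw [dimKer]
    congr 1
  have h3 : (EllTwo.autMap σ).symm (EllTwo.delta 1) = EllTwo.delta 1 := by
    rw [LinearIsometryEquiv.symm_apply_eq, EllTwo.autMap_delta_one]
  rw [h2, dimKer, vnDim_eq_norm_sq, vnDim_eq_norm_sq, Submodule.starProjection_map_apply, h3,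
    LinearIsometryEquiv.norm_map]

end GroupVN

/-! ### Dimension and invariance in finite sums of copies of `ℓ²(Γ)`. -/

section Frame

variable {Γ : Type*} [Group Γ] {H : Type*} [NormedAddCommGroup H] [InnerProductSpace ℂ H]
  {ι : Type*}

/-- The von Neumann dimension of a closed subspace of `H`. -/
def frameDim [Fintype ι] (e : ι → EllTwo Γ →L[ℂ] H) (V : Submodule ℂ H)
    [V.HasOrthogonalProjection] : ℝ :=
  ∑ i, ‖V.starProjection (e i (EllTwo.delta 1))‖ ^ 2

theorem frameDim_mono [Fintype ι] {e : ι → EllTwo Γ →L[ℂ] H} {V W : Submodule ℂ H}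
    [V.HasOrthogonalProjection]
    [W.HasOrthogonalProjection] (h : V ≤ W) : frameDim e V ≤ frameDim e W := by
  refine Finset.sum_le_sum fun i _ => ?_
  gcongr
  exact norm_starProjection_apply_mono h _

theorem frameDim_eq_sum_re_inner [Fintype ι] (e : ι → EllTwo Γ →L[ℂ] H) (V : Submodule ℂ H)
    [V.HasOrthogonalProjection] : frameDim e V = ∑ i, (inner ℂ (e i (EllTwo.delta 1))
      (V.starProjection (e i (EllTwo.delta 1)))).re :=
  Finset.sum_congr rfl fun _ _ => (re_inner_starProjection_self V _).symm

variable [CompleteSpace H]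

/-- Isometric embeddings `e i : ℓ²(Γ) → H` with orthogonal ranges that add up to `H`. -/
structure IsFrame [Fintype ι] (e : ι → EllTwo Γ →L[ℂ] H) : Prop where
  adjoint_comp_self : ∀ i, (e i)† ∘L e i = 1
  adjoint_comp_of_ne : ∀ i j, i ≠ j → (e i)† ∘L e j = 0
  sum_comp_adjoint : ∑ i, e i ∘L (e i)† = 1

/-- The operator `T : H → ℓ²(Γ)` commutes with the right action of `Γ`, in terms of its entries. -/
def IsEquivariantMap (e : ι → EllTwo Γ →L[ℂ] H) (T : H →L[ℂ] EllTwo Γ) : Prop :=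
  ∀ i, T ∘L e i ∈ groupVN Γ

/-- The closed subspace `V` of `H` is `Γ`-invariant, in terms of the entries of the projection
onto it. -/
def IsInvariantSubspace (e : ι → EllTwo Γ →L[ℂ] H) (V : Submodule ℂ H)
    [V.HasOrthogonalProjection] : Prop :=
  ∀ i j, (e i)† ∘L V.starProjection ∘L e j ∈ groupVN Γ

variable [Fintype ι] {e : ι → EllTwo Γ →L[ℂ] H}

theorem IsFrame.sum_adjoint_apply (he : IsFrame e) (x : H) : ∑ i, e i (((e i)†) x) = x := by
  simpa using congrArg (fun T : H →L[ℂ] H => T x) he.sum_comp_adjoint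

theorem IsFrame.adjoint_apply_self (he : IsFrame e) (i : ι) (x : EllTwo Γ) :
    ((e i)†) (e i x) = x :=
  congrArg (fun T : EllTwo Γ →L[ℂ] EllTwo Γ => T x) (he.adjoint_comp_self i)

theorem IsFrame.adjoint_comp_mem (he : IsFrame e) (i j : ι) : (e i)† ∘L e j ∈ groupVN Γ := by
  by_cases h : i = j
  · subst h
    rw [he.adjoint_comp_self]
    exact one_mem _
  · rw [he.adjoint_comp_of_ne i j h]
    exact zero_mem _

theorem IsFrame.isInvariantSubspace_top (he : IsFrame e) : IsInvariantSubspace e ⊤ := by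
  intro i j
  rw [Submodule.starProjection_top, id_comp]
  exact he.adjoint_comp_mem i j

theorem IsFrame.norm_apply (he : IsFrame e) (i : ι) (x : EllTwo Γ) : ‖e i x‖ = ‖x‖ := by
  have h : ‖e i x‖ ^ 2 = ‖x‖ ^ 2 := by
    rw [apply_norm_sq_eq_inner_adjoint_right, comp_apply, he.adjoint_apply_self,
      inner_self_eq_norm_sq]
  exact (sq_eq_sq₀ (norm_nonneg _) (norm_nonneg _)).1 h

theorem IsFrame.frameDim_top (he : IsFrame e) : frameDim e ⊤ = Fintype.card ι := by
  simp only [frameDim, Submodule.starProjection_top, coe_id', id, he.norm_apply,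
    EllTwo.norm_delta]
  simp

theorem frameDim_one (V : Submodule ℂ (EllTwo Γ)) [V.HasOrthogonalProjection] :
    frameDim (fun _ : Unit => (1 : EllTwo Γ →L[ℂ] EllTwo Γ)) V = vnDim V := by
  simp [frameDim, vnDim_eq_norm_sq]

end Frame

theorem isFrame_one (Γ : Type*) [Group Γ] :
    IsFrame (fun _ : Unit => (1 : EllTwo Γ →L[ℂ] EllTwo Γ)) where
  adjoint_comp_self _ := by
    rw [adjoint_one]; rfl
  adjoint_comp_of_ne i j h := (h (Subsingleton.elim i j)).elim
  sum_comp_adjoint := by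
    rw [Fintype.sum_unique, adjoint_one]; rfl

/-! ### Kernel projections as limits of averages. -/

section MeanErgodic

variable {E F : Type*} [NormedAddCommGroup E] [InnerProductSpace ℂ E] [CompleteSpace E]
  [NormedAddCommGroup F] [InnerProductSpace ℂ F] [CompleteSpace F]

theorem norm_one_sub_adjoint_comp_self_le {S : E →L[ℂ] F} (hS : ‖S‖ ≤ 1) :
    ‖1 - S† ∘L S‖ ≤ 1 := by
  refine opNorm_le_bound _ zero_le_one fun x => ?_
  rw [one_mul]
  refine le_of_sq_le_sq ?_ (norm_nonneg _)
  have h1 : ‖(S†) (S x)‖ ≤ ‖S x‖ := by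
    refine (le_opNorm _ _).trans ?_
    rw [LinearIsometryEquiv.norm_map]
    exact mul_le_of_le_one_left (norm_nonneg _) hS
  have h2 : (inner ℂ x ((S†) (S x))).re = ‖S x‖ ^ 2 := by
    rw [adjoint_inner_right]
    exact inner_self_eq_norm_sq (𝕜 := ℂ) _
  have h3 := norm_sub_sq (𝕜 := ℂ) x ((S†) (S x))
  have h4 : ‖(S†) (S x)‖ ^ 2 ≤ ‖S x‖ ^ 2 := by gcongr
  have h5 : (1 - S† ∘L S) x = x - (S†) (S x) := rfl
  rw [h5, h3]
  change ‖x‖ ^ 2 - 2 * (inner ℂ x ((S†) (S x))).re + _ ≤ _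
  rw [h2]
  nlinarith [sq_nonneg ‖S x‖]

/-- Von Neumann's mean ergodic theorem for `1 - S†S`. -/
theorem tendsto_average_one_sub_adjoint_comp_self {S : E →L[ℂ] F} (hS : ‖S‖ ≤ 1) (x : E) :
    Tendsto (fun n : ℕ => ((n : ℂ)⁻¹ • ∑ k ∈ Finset.range n, (1 - S† ∘L S) ^ k) x) atTop
      (𝓝 (S.ker.starProjection x)) := by
  have h := tendsto_birkhoffAverage_orthogonalProjection (1 - S† ∘L S)
    (norm_one_sub_adjoint_comp_self_le hS) x
  have hker : (1 - S† ∘L S).eqLocus (1 : E →L[ℂ] E) = S.ker := by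
    rw [← ker_adjoint_comp_self S]
    ext y
    simp [LinearMap.mem_eqLocus]
  have h2 : ((((1 - S† ∘L S).eqLocus (1 : E →L[ℂ] E)).orthogonalProjectionOnto x : _) : E)
      = S.ker.starProjection x := by
    rw [Submodule.coe_orthogonalProjectionOnto_apply]
    congr 2
  rw [h2] at h
  refine h.congr fun n => ?_
  simp [birkhoffAverage, birkhoffSum, sum_apply]

end MeanErgodic

/-! ### Rank-nullity for equivariant operators. -/

section RankNullity

variable {Γ : Type*} [Group Γ] {H : Type*} [NormedAddCommGroup H] [InnerProductSpace ℂ H]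
  [CompleteSpace H] {ι : Type*} [Fintype ι] {e : ι → EllTwo Γ →L[ℂ] H}

theorem IsFrame.comp_adjoint_eq_sum (he : IsFrame e) (S : H →L[ℂ] EllTwo Γ) :
    S ∘L S† = ∑ i, (S ∘L e i) ∘L (S ∘L e i)† := by
  ext1 x
  simp only [sum_apply, comp_apply, adjoint_comp]
  rw [← map_sum, he.sum_adjoint_apply]

theorem IsFrame.comp_adjoint_mem (he : IsFrame e) {S : H →L[ℂ] EllTwo Γ}
    (hS : IsEquivariantMap e S) : S ∘L S† ∈ groupVN Γ := by
  rw [he.comp_adjoint_eq_sum]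
  exact sum_mem fun i _ => comp_mem_groupVN (hS i) (adjoint_mem_groupVN (hS i))

theorem IsFrame.sum_inner_adjoint_comp (he : IsFrame e) {S : H →L[ℂ] EllTwo Γ}
    (hS : IsEquivariantMap e S) {X : EllTwo Γ →L[ℂ] EllTwo Γ} (hX : X ∈ groupVN Γ) :
    ∑ i, inner ℂ (e i (EllTwo.delta 1)) ((S† ∘L X ∘L S) (e i (EllTwo.delta 1)))
      = vnTrace (X ∘L S ∘L S†) := by
  have h : ∀ i, inner ℂ (e i (EllTwo.delta 1)) ((S† ∘L X ∘L S) (e i (EllTwo.delta 1)))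
      = vnTrace (X ∘L (S ∘L e i) ∘L (S ∘L e i)†) := by
    intro i
    have h2 := vnTrace_mul_comm (adjoint_mem_groupVN (hS i)) (comp_mem_groupVN hX (hS i))
    rw [← comp_assoc X, ← h2, vnTrace_eq, comp_apply, adjoint_inner_right, comp_apply,
      comp_apply, adjoint_inner_right]
    rfl
  simp only [h, vnTrace_eq]
  rw [← inner_sum, he.comp_adjoint_eq_sum]
  congr 1
  simp only [comp_apply, sum_apply, map_sum]

/-- The same `X` serves `S†S` and `SS†`, so the trace property can compare the traces of the two
powers. -/
theorem exists_one_sub_pow_eq (he : IsFrame e) {S : H →L[ℂ] EllTwo Γ}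
    (hS : IsEquivariantMap e S) (k : ℕ) :
    ∃ X ∈ groupVN Γ, (1 - S† ∘L S) ^ k = 1 - S† ∘L X ∘L S ∧
      (1 - S ∘L S†) ^ k = 1 - X ∘L S ∘L S† := by
  induction k with
  | zero => exact ⟨0, zero_mem _, by simp, by simp⟩
  | succ k ih =>
    obtain ⟨X, hX, h1, h2⟩ := ih
    -- The new `X` is read off from `(1 - S†XS)(1 - S†S) = 1 - S†(X + 1 - XSS†)S`.
    refine ⟨X + 1 - X ∘L (S ∘L S†), sub_mem (add_mem hX (one_mem _))
      (comp_mem_groupVN hX (he.comp_adjoint_mem hS)), ?_, ?_⟩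
    · rw [pow_succ, h1]
      ext1 x
      simp only [mul_apply_eq_comp, sub_apply, add_apply, comp_apply, one_apply_eq_self, map_sub,
        map_add]
      abel
    · rw [pow_succ, h2]
      ext1 x
      simp only [mul_apply_eq_comp, sub_apply, add_apply, comp_apply, one_apply_eq_self, map_sub]
      abel

theorem IsFrame.sum_inner_one_sub_pow (he : IsFrame e) {S : H →L[ℂ] EllTwo Γ}
    (hS : IsEquivariantMap e S) (k : ℕ) :
    ∑ i, inner ℂ (e i (EllTwo.delta 1)) (((1 - S† ∘L S) ^ k) (e i (EllTwo.delta 1)))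
      = Fintype.card ι - 1 + inner ℂ (EllTwo.delta 1) (((1 - S ∘L S†) ^ k) (EllTwo.delta 1)) := by
  obtain ⟨X, hX, h1, h2⟩ := exists_one_sub_pow_eq he hS k
  have h3 := he.sum_inner_adjoint_comp hS hX
  rw [vnTrace_eq] at h3
  rw [h1, h2]
  simp only [sub_apply, one_apply_eq_self, inner_sub_right, Finset.sum_sub_distrib, h3,
    inner_self_eq_norm_sq_to_K, he.norm_apply, EllTwo.norm_delta]
  simp

/-- The averages of the powers of `1 - S†S` and `1 - SS†` converge strongly to the projections onto
the two kernels, while their traces differ by the constant `card ι - 1`. -/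
theorem IsFrame.frameDim_ker_of_norm_le_one (he : IsFrame e) {S : H →L[ℂ] EllTwo Γ}
    (hS : IsEquivariantMap e S) (hn : ‖S‖ ≤ 1) :
    frameDim e S.ker = Fintype.card ι - 1 + vnDim (S†).ker := by
  have hn' : ‖S†‖ ≤ 1 := by rwa [LinearIsometryEquiv.norm_map]
  have hA : Tendsto (fun n : ℕ => ∑ i, (inner ℂ (e i (EllTwo.delta 1))
      (((n : ℂ)⁻¹ • ∑ k ∈ Finset.range n, (1 - S† ∘L S) ^ k) (e i (EllTwo.delta 1)))).re) atTop
      (𝓝 (frameDim e S.ker)) := by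
    rw [frameDim_eq_sum_re_inner]
    refine tendsto_finsetSum _ fun i _ => ?_
    exact (Complex.continuous_re.tendsto _).comp
      (tendsto_const_nhds.inner (tendsto_average_one_sub_adjoint_comp_self hn _))
  have hB : Tendsto (fun n : ℕ => ((Fintype.card ι : ℝ) - 1) + (inner ℂ (EllTwo.delta 1)
      (((n : ℂ)⁻¹ • ∑ k ∈ Finset.range n, (1 - S ∘L S†) ^ k)
        (EllTwo.delta (1 : Γ)))).re) atTop (𝓝 (Fintype.card ι - 1 + vnDim (S†).ker)) := by
    have h := tendsto_average_one_sub_adjoint_comp_self hn' (EllTwo.delta (1 : Γ))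
    rw [adjoint_adjoint] at h
    exact tendsto_const_nhds.add ((Complex.continuous_re.tendsto _).comp
      (tendsto_const_nhds.inner h))
  refine tendsto_nhds_unique hA (hB.congr' ?_)
  -- The average with `n = 0` is `0`, so the identity of traces needs `n > 0`.
  filter_upwards [eventually_gt_atTop 0] with n hpos
  have hn0 : (n : ℂ) ≠ 0 := by exact_mod_cast hpos.ne'
  have key : ∑ i, inner ℂ (e i (EllTwo.delta 1))
      (((n : ℂ)⁻¹ • ∑ k ∈ Finset.range n, (1 - S† ∘L S) ^ k) (e i (EllTwo.delta 1)))
      = ((Fintype.card ι : ℂ) - 1) + inner ℂ (EllTwo.delta 1)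
      (((n : ℂ)⁻¹ • ∑ k ∈ Finset.range n, (1 - S ∘L S†) ^ k) (EllTwo.delta (1 : Γ))) := by
    simp only [smul_apply, sum_apply, inner_smul_right, inner_sum]
    rw [← Finset.mul_sum, Finset.sum_comm]
    simp only [he.sum_inner_one_sub_pow hS, Finset.sum_add_distrib, Finset.sum_const,
      Finset.card_range, nsmul_eq_mul]
    field_simp
  rw [← Complex.re_sum, key]
  simp

/-- The entries of the averages lie in `𝒩Γ`, which is closed under strong limits of sequences. -/
theorem IsFrame.isInvariantSubspace_ker_of_norm_le_one (he : IsFrame e) {S : H →L[ℂ] EllTwo Γ}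
    (hS : IsEquivariantMap e S) (hn : ‖S‖ ≤ 1) : IsInvariantSubspace e S.ker := by
  intro i j
  refine mem_groupVN_of_tendsto (T := fun n => (e i)† ∘L
    ((n : ℂ)⁻¹ • ∑ k ∈ Finset.range n, (1 - S† ∘L S) ^ k) ∘L e j) (fun n => ?_) fun x => ?_
  · have h : (e i)† ∘L ((n : ℂ)⁻¹ • ∑ k ∈ Finset.range n, (1 - S† ∘L S) ^ k) ∘L e j
      = (n : ℂ)⁻¹ • ∑ k ∈ Finset.range n, (e i)† ∘L ((1 - S† ∘L S) ^ k) ∘L e j := by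
      ext1 x
      simp only [comp_apply, smul_apply, sum_apply, map_smul, map_sum]
    rw [h]
    refine (groupVN Γ).smul_mem (sum_mem fun k _ => ?_) _
    obtain ⟨X, hX, h1, -⟩ := exists_one_sub_pow_eq he hS k
    have h2 : (e i)† ∘L ((1 - S† ∘L S) ^ k) ∘L e j
        = (e i)† ∘L e j - (S ∘L e i)† ∘L X ∘L (S ∘L e j) := by
      rw [h1]
      ext1 x
      simp only [comp_apply, sub_apply, one_apply_eq_self, map_sub, adjoint_comp]
    rw [h2]
    exact sub_mem (he.adjoint_comp_mem i j)
      (comp_mem_groupVN (adjoint_mem_groupVN (hS i)) (comp_mem_groupVN hX (hS j)))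
  · exact ((e i)†).continuous.tendsto _ |>.comp
      (tendsto_average_one_sub_adjoint_comp_self hn (e j x))

theorem IsFrame.exists_norm_le_one (e : ι → EllTwo Γ →L[ℂ] H) {S : H →L[ℂ] EllTwo Γ}
    (hS : IsEquivariantMap e S) : ∃ S' : H →L[ℂ] EllTwo Γ, IsEquivariantMap e S' ∧ ‖S'‖ ≤ 1 ∧
      S'.ker = S.ker ∧ (S'†).ker = (S†).ker := by
  have hpos : 0 < ‖S‖ + 1 := by positivity
  have hc : ((‖S‖ + 1 : ℝ) : ℂ)⁻¹ ≠ 0 := inv_ne_zero (by exact_mod_cast hpos.ne')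
  refine ⟨((‖S‖ + 1 : ℝ) : ℂ)⁻¹ • S, fun i => ?_, ?_, ?_, ?_⟩
  · rw [smul_comp]
    exact (groupVN Γ).smul_mem (hS i) _
  · rw [norm_smul, norm_inv, Complex.norm_real, Real.norm_of_nonneg hpos.le,
      inv_mul_le_one₀ hpos]
    linarith
  · ext x
    simp [hc, -Complex.ofReal_add]
  · rw [map_smulₛₗ]
    ext x
    simp [hc, -Complex.ofReal_add]

/-- Rank-nullity: the von Neumann index of an equivariant operator is the difference of the
dimensions of its domain and its codomain. -/
theorem IsFrame.frameDim_ker (he : IsFrame e) {S : H →L[ℂ] EllTwo Γ}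
    (hS : IsEquivariantMap e S) :
    frameDim e S.ker = Fintype.card ι - 1 + vnDim (S†).ker := by
  obtain ⟨S', h1, h2, h3, h4⟩ := IsFrame.exists_norm_le_one e hS
  have h := he.frameDim_ker_of_norm_le_one h1 h2
  simp only [h3, h4] at h
  exact h

theorem IsFrame.isInvariantSubspace_ker (he : IsFrame e) {S : H →L[ℂ] EllTwo Γ}
    (hS : IsEquivariantMap e S) : IsInvariantSubspace e S.ker := by
  obtain ⟨S', h1, h2, h3, -⟩ := IsFrame.exists_norm_le_one e hS
  have h := he.isInvariantSubspace_ker_of_norm_le_one h1 h2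
  simp only [h3] at h
  exact h

end RankNullity

/-! ### Rank-nullity on invariant subspaces. -/

section Restriction

variable {Γ : Type*} [Group Γ] {H : Type*} [NormedAddCommGroup H] [InnerProductSpace ℂ H]

/-- The kernel of `f P_V` is the orthogonal sum of `Vᗮ` and `V ⊓ ker f`. This replaces the
restriction of `f` to `V` by an operator on all of `H`. -/
theorem ker_comp_starProjection_starProjection {F : Type*} [NormedAddCommGroup F]
    [InnerProductSpace ℂ F] (V : Submodule ℂ H) [V.HasOrthogonalProjection]
    (f : H →L[ℂ] F) [(V ⊓ f.ker).HasOrthogonalProjection]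
    [(f ∘L V.starProjection).ker.HasOrthogonalProjection] :
    (f ∘L V.starProjection).ker.starProjection
      = 1 - V.starProjection + (V ⊓ f.ker).starProjection := by
  ext1 x
  symm
  have hle : V ⊓ f.ker ≤ V := inf_le_left
  have hW := (V ⊓ f.ker).starProjection_apply_mem x
  have hPW : V.starProjection ((V ⊓ f.ker).starProjection x) = (V ⊓ f.ker).starProjection x :=
    V.starProjection_eq_self_iff.2 (hle hW)
  have hPP : V.starProjection (V.starProjection x) = V.starProjection x :=
    V.starProjection_eq_self_iff.2 (V.starProjection_apply_mem x)
  have hx : (1 - V.starProjection + (V ⊓ f.ker).starProjection) x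
    = x - V.starProjection x + (V ⊓ f.ker).starProjection x := rfl
  rw [hx]
  symm
  refine Submodule.eq_starProjection_of_mem_of_inner_eq_zero ?_ fun w hw => ?_
  · rw [LinearMap.mem_ker, coe_coe, comp_apply, map_add, map_sub, hPP, hPW, sub_self, zero_add]
    exact hW.2
  · have h1 : x - (x - V.starProjection x + (V ⊓ f.ker).starProjection x)
        = V.starProjection (x - (V ⊓ f.ker).starProjection x) := by
      rw [map_sub, hPW]; abel
    rw [h1, V.inner_starProjection_left_eq_right]
    exact (V ⊓ f.ker).starProjection_inner_eq_zero x _ ⟨V.starProjection_apply_mem w, hw⟩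

variable [CompleteSpace H]

theorem ker_adjoint_comp_starProjection {F : Type*} [NormedAddCommGroup F]
    [InnerProductSpace ℂ F] [CompleteSpace F] (V : Submodule ℂ H) [V.HasOrthogonalProjection]
    (f : H →L[ℂ] F) : ((f ∘L V.starProjection)†).ker = (V.map (f : H →ₗ[ℂ] F))ᗮ := by
  ext y
  rw [LinearMap.mem_ker, coe_coe, Submodule.mem_orthogonal]
  constructor
  · rintro h _ ⟨v, hv, rfl⟩
    have h2 : inner ℂ v (((f ∘L V.starProjection)†) y) = 0 := by rw [h, inner_zero_right]
    rw [adjoint_inner_right, comp_apply, V.starProjection_eq_self_iff.2 hv] at h2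
    exact h2
  · intro h
    refine ext_inner_left ℂ fun v => ?_
    rw [adjoint_inner_right, inner_zero_right]
    exact h _ ⟨_, V.starProjection_apply_mem v, rfl⟩

variable {ι : Type*} [Fintype ι] {e : ι → EllTwo Γ →L[ℂ] H}

theorem IsFrame.isEquivariantMap_comp_starProjection (he : IsFrame e) {V : Submodule ℂ H}
    [V.HasOrthogonalProjection] (hV : IsInvariantSubspace e V) {f : H →L[ℂ] EllTwo Γ}
    (hf : IsEquivariantMap e f) : IsEquivariantMap e (f ∘L V.starProjection) := by
  intro j
  have h : (f ∘L V.starProjection) ∘L e j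
      = ∑ i, (f ∘L e i) ∘L ((e i)† ∘L V.starProjection ∘L e j) := by
    ext1 x
    simp only [comp_apply, sum_apply]
    rw [← map_sum, he.sum_adjoint_apply]
  rw [h]
  exact sum_mem fun i _ => comp_mem_groupVN (hf i) (hV i j)

theorem IsFrame.isInvariantSubspace_inf_ker (he : IsFrame e) {V : Submodule ℂ H}
    [V.HasOrthogonalProjection] (hV : IsInvariantSubspace e V) {f : H →L[ℂ] EllTwo Γ}
    (hf : IsEquivariantMap e f) [(V ⊓ f.ker).HasOrthogonalProjection] :
    IsInvariantSubspace e (V ⊓ f.ker) := by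
  intro i j
  have h1 := he.isInvariantSubspace_ker (he.isEquivariantMap_comp_starProjection hV hf) i j
  rw [ker_comp_starProjection_starProjection] at h1
  have h2 : (e i)† ∘L (V ⊓ f.ker).starProjection ∘L e j
      = (e i)† ∘L (1 - V.starProjection + (V ⊓ f.ker).starProjection) ∘L e j - (e i)† ∘L e j
        + (e i)† ∘L V.starProjection ∘L e j := by
    ext1 x
    simp only [comp_apply, add_apply, sub_apply, one_apply_eq_self, map_add, map_sub]
    abel
  rw [h2]
  exact add_mem (sub_mem h1 (he.adjoint_comp_mem i j)) (hV i j)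

/-- Rank-nullity for the restriction of `f` to an invariant subspace. -/
theorem IsFrame.frameDim_inf_ker (he : IsFrame e) {V : Submodule ℂ H}
    [V.HasOrthogonalProjection] (hV : IsInvariantSubspace e V) {f : H →L[ℂ] EllTwo Γ}
    (hf : IsEquivariantMap e f) [(V ⊓ f.ker).HasOrthogonalProjection] :
    frameDim e (V ⊓ f.ker) = frameDim e V - 1 + vnDim (V.map (f : H →ₗ[ℂ] EllTwo Γ))ᗮ := by
  have h1 := he.frameDim_ker (he.isEquivariantMap_comp_starProjection hV hf)
  have h2 := he.frameDim_top
  simp only [ker_adjoint_comp_starProjection] at h1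
  rw [frameDim_eq_sum_re_inner] at h1 h2 ⊢
  rw [frameDim_eq_sum_re_inner e V]
  simp only [Submodule.starProjection_top'] at h2
  rw [ker_comp_starProjection_starProjection] at h1
  simp only [add_apply, sub_apply, inner_add_right, inner_sub_right, Complex.add_re,
    Complex.sub_re, Finset.sum_add_distrib, Finset.sum_sub_distrib, h2] at h1
  linarith

theorem IsFrame.frameDim_sub_one_le (he : IsFrame e) {V : Submodule ℂ H}
    [V.HasOrthogonalProjection] (hV : IsInvariantSubspace e V) {f : H →L[ℂ] EllTwo Γ}
    (hf : IsEquivariantMap e f) [(V ⊓ f.ker).HasOrthogonalProjection] :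
    frameDim e V - 1 ≤ frameDim e (V ⊓ f.ker) := by
  rw [he.frameDim_inf_ker hV hf, vnDim_eq_norm_sq]
  exact le_add_of_nonneg_right (sq_nonneg _)

/-- If `g` vanishes on `f(V)`, the dimension drops by at most `1 - dim ker g`. -/
theorem IsFrame.frameDim_inf_ker_ge (he : IsFrame e) {V : Submodule ℂ H}
    [V.HasOrthogonalProjection] (hV : IsInvariantSubspace e V) {f : H →L[ℂ] EllTwo Γ}
    (hf : IsEquivariantMap e f) [(V ⊓ f.ker).HasOrthogonalProjection] (g : groupVN Γ)
    (hg : ∀ x ∈ V, (g : EllTwo Γ →L[ℂ] EllTwo Γ) (f x) = 0) :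
    frameDim e V - dimKer g ≤ frameDim e (V ⊓ f.ker) := by
  have h : V.map (f : H →ₗ[ℂ] EllTwo Γ) ≤ (g : EllTwo Γ →L[ℂ] EllTwo Γ).ker := by
    rintro _ ⟨x, hx, rfl⟩
    exact hg x hx
  have h2 := vnDim_mono (Submodule.orthogonal_le h)
  rw [vnDim_orthogonal] at h2
  rw [he.frameDim_inf_ker hV hf, dimKer]
  linarith

/-- The operator `b` maps `ker (ab)` into `ker a`, and its kernel there is `ker b`. -/
theorem dimKer_mul_le (a b : groupVN Γ) : dimKer (a * b) ≤ dimKer a + dimKer b := by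
  have hcomp : ((a * b : groupVN Γ) : EllTwo Γ →L[ℂ] EllTwo Γ)
    = (a : EllTwo Γ →L[ℂ] EllTwo Γ) ∘L (b : EllTwo Γ →L[ℂ] EllTwo Γ) := rfl
  have he := isFrame_one Γ
  have heq : ∀ c : groupVN Γ, IsEquivariantMap (fun _ : Unit => (1 : EllTwo Γ →L[ℂ] EllTwo Γ))
    (c : EllTwo Γ →L[ℂ] EllTwo Γ) := fun c _ => c.2
  have hinf : ((a * b : groupVN Γ) : EllTwo Γ →L[ℂ] EllTwo Γ).ker
      ⊓ (b : EllTwo Γ →L[ℂ] EllTwo Γ).ker = (b : EllTwo Γ →L[ℂ] EllTwo Γ).ker := by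
    refine inf_of_le_right fun x hx => ?_
    rw [LinearMap.mem_ker, coe_coe] at hx
    rw [LinearMap.mem_ker, coe_coe, hcomp, comp_apply, hx, map_zero]
  have : (((a * b : groupVN Γ) : EllTwo Γ →L[ℂ] EllTwo Γ).ker
      ⊓ (b : EllTwo Γ →L[ℂ] EllTwo Γ).ker).HasOrthogonalProjection := by
    rw [hinf]; infer_instance
  have h := he.frameDim_inf_ker_ge (he.isInvariantSubspace_ker (heq (a * b))) (heq b) a
    (fun x hx => hx)
  simp only [hinf, frameDim_one] at h
  rw [dimKer, dimKer.eq_1 b]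
  linarith

end Restriction

/-! ### Solution spaces of finite systems of equations. -/

section JointKernel

variable {H : Type*} [NormedAddCommGroup H] [InnerProductSpace ℂ H] [CompleteSpace H]
  {F : Type*} [NormedAddCommGroup F] [InnerProductSpace ℂ F] {α : Type*}

instance hasOrthogonalProjection_inf_ker (V : Submodule ℂ H) [V.HasOrthogonalProjection]
    (f : H →L[ℂ] F) : (V ⊓ f.ker).HasOrthogonalProjection := by
  have hV : IsClosed (V : Set H) := by
    rw [← V.orthogonal_orthogonal]
    exact Vᗮ.isClosed_orthogonal
  have h : IsClosed ((V ⊓ f.ker : Submodule ℂ H) : Set H) := hV.inter f.isClosed_ker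
  have : CompleteSpace (V ⊓ f.ker : Submodule ℂ H) := h.completeSpace_coe
  infer_instance

/-- The common kernel of the operators `T k`, `k ∈ s`. -/
def jointKer (T : α → H →L[ℂ] F) (s : Finset α) : Submodule ℂ H := ⨅ k ∈ s, (T k).ker

theorem mem_jointKer {T : α → H →L[ℂ] F} {s : Finset α} {x : H} :
    x ∈ jointKer T s ↔ ∀ k ∈ s, T k x = 0 := by
  simp [jointKer, Submodule.mem_iInf]

instance jointKer_hasOrthogonalProjection (T : α → H →L[ℂ] F) (s : Finset α) :
    (jointKer T s).HasOrthogonalProjection := by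
  have h : IsClosed (jointKer T s : Set H) := by
    simp only [jointKer, Submodule.coe_iInf]
    exact isClosed_iInter fun k => isClosed_iInter fun _ => (T k).isClosed_ker
  have : CompleteSpace (jointKer T s) := h.completeSpace_coe
  infer_instance

theorem jointKer_empty (T : α → H →L[ℂ] F) : jointKer T ∅ = ⊤ := by
  simp [jointKer]

theorem jointKer_insert [DecidableEq α] (T : α → H →L[ℂ] F) (k : α) (s : Finset α) :
    jointKer T (insert k s) = jointKer T s ⊓ (T k).ker := by
  rw [jointKer, Finset.iInf_insert, inf_comm]
  rfl

variable {Γ : Type*} [Group Γ] {ι : Type*} [Fintype ι] {e : ι → EllTwo Γ →L[ℂ] H}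

theorem IsFrame.isInvariantSubspace_jointKer (he : IsFrame e) {T : α → H →L[ℂ] EllTwo Γ}
    (hT : ∀ k, IsEquivariantMap e (T k)) (s : Finset α) :
    IsInvariantSubspace e (jointKer T s) := by
  classical
  induction s using Finset.induction_on with
  | empty => simpa only [jointKer_empty] using he.isInvariantSubspace_top
  | insert k s _ ih =>
    simpa only [jointKer_insert] using he.isInvariantSubspace_inf_ker ih (hT k)

theorem IsFrame.card_sub_card_le_frameDim_jointKer (he : IsFrame e)
    {T : α → H →L[ℂ] EllTwo Γ} (hT : ∀ k, IsEquivariantMap e (T k)) (s : Finset α) :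
    (Fintype.card ι : ℝ) - s.card ≤ frameDim e (jointKer T s) := by
  classical
  induction s using Finset.induction_on with
  | empty =>
    simp only [jointKer_empty]
    rw [he.frameDim_top]
    simp
  | insert k s hk ih =>
    simp only [jointKer_insert]
    have h := he.frameDim_sub_one_le (he.isInvariantSubspace_jointKer hT s) (hT k)
    rw [Finset.card_insert_of_notMem hk]
    push_cast
    linarith

theorem IsFrame.frameDim_bot : frameDim e ⊥ = 0 := by
  simp [frameDim]

theorem ker_comp_starProjection_comp_adjoint (V : Submodule ℂ H) [V.HasOrthogonalProjection]
    [CompleteSpace F] (f : H →L[ℂ] F) :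
    (f ∘L V.starProjection ∘L f†).ker = (V.map (f : H →ₗ[ℂ] F))ᗮ := by
  have h : f ∘L V.starProjection ∘L f† = (f ∘L V.starProjection) ∘L (f ∘L V.starProjection)† := by
    ext1 x
    rw [adjoint_comp, (isSelfAdjoint_starProjection V).adjoint_eq]
    simp only [comp_apply]
    rw [V.starProjection_eq_self_iff.2 (V.starProjection_apply_mem _)]
  rw [h, ker_self_comp_adjoint, ker_adjoint_comp_starProjection]

/-- The orthogonal complement of the `i`-th coordinate projection of `V` is the kernel of the
diagonal entry at `i` of the projection onto `V`. -/
theorem IsFrame.frameDim_inf_ker_adjoint (he : IsFrame e) {V : Submodule ℂ H}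
    [V.HasOrthogonalProjection] (hV : IsInvariantSubspace e V) (i : ι) :
    frameDim e (V ⊓ ((e i)†).ker) = frameDim e V - 1 + dimKer ⟨_, hV i i⟩ := by
  have h := ker_comp_starProjection_comp_adjoint V ((e i)†)
  rw [adjoint_adjoint] at h
  rw [he.frameDim_inf_ker hV (f := (e i)†) (he.adjoint_comp_mem i), dimKer]
  simp only [h]

end JointKernel

/-! ### The standard frame of `ℓ²(Γ)^ι`. -/

section Frames

variable (Γ : Type*) [Group Γ] (ι : Type*) [Fintype ι]

/-- The coordinate embeddings of `ℓ²(Γ)` into `ℓ²(Γ)^ι`. -/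
def coordEmbedding (i : ι) : EllTwo Γ →L[ℂ] PiLp 2 (fun _ : ι => EllTwo Γ) :=
  (PiLp.proj (𝕜 := ℂ) 2 (fun _ : ι => EllTwo Γ) i)†

theorem coordEmbedding_apply [DecidableEq ι] (i : ι) (x : EllTwo Γ) :
    coordEmbedding Γ ι i x = PiLp.single 2 i x := by
  refine ext_inner_right ℂ fun y => ?_
  rw [coordEmbedding, adjoint_inner_left, PiLp.inner_apply, Finset.sum_eq_single i]
  · simp
  · intro j _ hj
    rw [PiLp.single_eq_of_ne _ hj, inner_zero_left]
  · simp

theorem isFrame_coordEmbedding : IsFrame (coordEmbedding Γ ι) where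
  adjoint_comp_self i := by
    classical
    ext1 x
    rw [comp_apply, coordEmbedding_apply, coordEmbedding, adjoint_adjoint]
    simp
  adjoint_comp_of_ne i j hij := by
    classical
    ext1 x
    rw [comp_apply, coordEmbedding_apply, coordEmbedding, adjoint_adjoint]
    exact PiLp.single_eq_of_ne (β := fun _ : ι => EllTwo Γ) 2 hij x
  sum_comp_adjoint := by
    ext1 x
    refine ext_inner_right ℂ fun y => ?_
    rw [sum_apply, sum_inner, one_apply_eq_self, PiLp.inner_apply]
    refine Finset.sum_congr rfl fun i _ => ?_
    rw [comp_apply, coordEmbedding, adjoint_adjoint, adjoint_inner_left]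
    rfl

end Frames

/-! ### Triangular systems over `𝒩Γ`. -/

section LinearSystem

variable {Γ : Type*} [Group Γ]

theorem exists_solution_triangular (m d : ℕ) (A A' : ℕ → Fin m → groupVN Γ)
    (hA : ∀ c j : Fin m, c < j → A c j = 0) (hA' : ∀ c j : Fin m, c < j → A' c j = 0)
    (κ ε : ℝ) (hκ : ∀ j : Fin m, dimKer (A' j j) = κ) (hd : d < m * ε) :
    ∃ (i : Fin m) (R R' : Fin m → groupVN Γ), (∀ j < i, R j = 0 ∧ R' j = 0) ∧
      (∀ c < m + d, ∑ j, A c j * R j = ∑ j, A' c j * R' j) ∧ dimKer (R i) < κ + ε := by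
  classical
  -- The coordinates `(false, j)` hold `R j` and the coordinates `(true, j)` hold `R' j`.
  set ι := Bool × Fin m
  set e := coordEmbedding Γ ι
  have he : IsFrame e := isFrame_coordEmbedding Γ ι
  let T : ℕ ⊕ ι → PiLp 2 (fun _ : ι => EllTwo Γ) →L[ℂ] EllTwo Γ := Sum.elim
    (fun c => ∑ j, ((A c j : EllTwo Γ →L[ℂ] EllTwo Γ) ∘L (e (false, j))†
      - (A' c j : EllTwo Γ →L[ℂ] EllTwo Γ) ∘L (e (true, j))†)) (fun k => (e k)†)
  have hTl : ∀ c x, T (Sum.inl c) x = ∑ j, ((A c j : EllTwo Γ →L[ℂ] EllTwo Γ)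
      (((e (false, j))†) x) - (A' c j : EllTwo Γ →L[ℂ] EllTwo Γ) (((e (true, j))†) x)) := by
    intro c x
    simp only [T, Sum.elim_inl, sum_apply, sub_apply, comp_apply]
  have hT : ∀ k, IsEquivariantMap e (T k) := by
    rintro (c | k) l
    · have h : T (Sum.inl c) ∘L e l = ∑ j, ((A c j : EllTwo Γ →L[ℂ] EllTwo Γ) ∘L
          ((e (false, j))† ∘L e l) - (A' c j : EllTwo Γ →L[ℂ] EllTwo Γ) ∘L
          ((e (true, j))† ∘L e l)) := by
        ext1 x
        simp only [comp_apply, hTl, sum_apply, sub_apply]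
      rw [h]
      exact sum_mem fun j _ => sub_mem (comp_mem_groupVN (A c j).2 (he.adjoint_comp_mem _ _))
        (comp_mem_groupVN (A' c j).2 (he.adjoint_comp_mem _ _))
    · exact he.adjoint_comp_mem k l
  let W : ℕ → Submodule ℂ (PiLp 2 (fun _ : ι => EllTwo Γ)) := fun i =>
    jointKer T ((Finset.range (m + d)).disjSum (Finset.univ.filter fun k : ι => (k.2 : ℕ) < i))
  have memW : ∀ i x, x ∈ W i ↔ (∀ c < m + d, T (Sum.inl c) x = 0) ∧
      ∀ k : ι, (k.2 : ℕ) < i → ((e k)†) x = 0 := by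
    intro i x
    simp only [W, mem_jointKer, Sum.forall, Finset.inl_mem_disjSum, Finset.inr_mem_disjSum,
      Finset.mem_range, Finset.mem_filter, Finset.mem_univ, true_and]
    rfl
  have hWproj : ∀ i, (W i).HasOrthogonalProjection := fun i => by
    simp only [W]; infer_instance
  have hWinv : ∀ i, IsInvariantSubspace e (W i) := fun i =>
    he.isInvariantSubspace_jointKer hT _
  -- There are `2m` unknowns, and each of the `m + d` equations costs at most one dimension.
  have h0 : (m : ℝ) - d ≤ frameDim e (W 0) := by
    have h := he.card_sub_card_le_frameDim_jointKer hT
      ((Finset.range (m + d)).disjSum (Finset.univ.filter fun k : ι => (k.2 : ℕ) < 0))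
    refine le_trans (le_of_eq ?_) h
    rw [Finset.card_disjSum]
    simp [ι]
    ring
  have hm : frameDim e (W m) = 0 := by
    rw [← IsFrame.frameDim_bot (e := e)]
    refine le_antisymm (frameDim_mono fun x hx => ?_) (frameDim_mono bot_le)
    rw [Submodule.mem_bot, ← he.sum_adjoint_apply x]
    exact Finset.sum_eq_zero fun k _ => by rw [((memW m x).1 hx).2 k k.2.2, map_zero]
  have hstep : ∀ i : Fin m, frameDim e (W i) - 1
      + dimKer ⟨_, hWinv i (false, i) (false, i)⟩ - κ ≤ frameDim e (W (i + 1)) := by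
    intro i
    have h1 := he.frameDim_inf_ker_adjoint (hWinv i) (false, i)
    have h2 := he.frameDim_inf_ker_ge (he.isInvariantSubspace_inf_ker (hWinv i)
      (hT (Sum.inr (false, i)))) (hT (Sum.inr (true, i))) (A' i i) (by
        rintro x ⟨hx, hx'⟩
        obtain ⟨hx1, hx2⟩ := (memW i x).1 hx
        -- In row `i` the terms with `j < i` vanish because `x` lies in `W i`, those with `j > i` by
        -- triangularity; what remains is the diagonal term of `A'`.
        have h3 := hx1 i (by omega)
        rw [hTl, Finset.sum_eq_single i] at h3
        · have hx'' : ((e (false, i))†) x = 0 := hx'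
          rw [hx'', map_zero, zero_sub, neg_eq_zero] at h3
          exact h3
        · intro j _ hj
          rcases lt_or_gt_of_ne hj with h | h
          · rw [hx2 (false, j) h, hx2 (true, j) h, map_zero, map_zero, sub_zero]
          · rw [hA i j h, hA' i j h]
            simp
        · simp)
    have h3 : W i ⊓ (T (Sum.inr (false, i))).ker ⊓ (T (Sum.inr (true, i))).ker ≤ W (i + 1) := by
      rintro x ⟨⟨hx, hx'⟩, hx''⟩
      obtain ⟨hx1, hx2⟩ := (memW i x).1 hx
      refine (memW _ x).2 ⟨hx1, ?_⟩
      rintro ⟨b, j⟩ hj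
      rcases Nat.lt_succ_iff_lt_or_eq.1 hj with h | h
      · exact hx2 _ h
      · obtain rfl : j = i := Fin.ext h
        cases b
        · exact hx'
        · exact hx''
    have h4 := frameDim_mono (e := e) h3
    rw [hκ] at h2
    change frameDim e (W i ⊓ (T (Sum.inr (false, i))).ker) = _ at h1
    linarith
  obtain ⟨i, hi⟩ : ∃ i : Fin m, dimKer ⟨_, hWinv i (false, i) (false, i)⟩ < κ + ε := by
    by_contra! hcon
    -- Otherwise each step loses at most `1 - ε`, which leaves `W m` with dimension at least `m ε -
    -- d > 0`.
    have h : ∀ n ≤ m, (m : ℝ) - d - n + n * ε ≤ frameDim e (W n) := by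
      intro n
      induction n with
      | zero => intro _; simpa using h0
      | succ n ih =>
        intro hn
        have h1 := ih (by omega)
        have h2 := hstep ⟨n, hn⟩
        have h3 := hcon ⟨n, hn⟩
        push_cast
        simp only at h2 h3
        linarith
    have h1 := h m le_rfl
    rw [hm] at h1
    linarith
  -- The solution is the column at `(false, i)` of the projection onto `W i`: the range of this
  -- projection consists of solutions vanishing before `i`.
  refine ⟨i, fun j => ⟨_, hWinv i (false, j) (false, i)⟩,
    fun j => ⟨_, hWinv i (true, j) (false, i)⟩, fun j hj => ⟨?_, ?_⟩, fun c hc => ?_, hi⟩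
  · refine Subtype.ext (ContinuousLinearMap.ext fun x => ?_)
    exact ((memW i _).1 ((W i).starProjection_apply_mem _)).2 (false, j) hj
  · refine Subtype.ext (ContinuousLinearMap.ext fun x => ?_)
    exact ((memW i _).1 ((W i).starProjection_apply_mem _)).2 (true, j) hj
  · rw [← sub_eq_zero, ← Finset.sum_sub_distrib]
    refine Subtype.ext (ContinuousLinearMap.ext fun x => ?_)
    have h := ((memW i _).1 ((W i).starProjection_apply_mem (e (false, i) x))).1 c hc
    rw [hTl] at h
    rw [AddSubmonoidClass.coe_finsetSum, sum_apply]
    exact h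

end LinearSystem

/-! ### Coefficients of twisted Laurent polynomials. -/

namespace TwistedLaurent

variable {R : Type*} [Ring R] {ν : Multiplicative ℤ →* RingAut R}

theorem ext_coeff {x y : TwistedLaurent R ν} (h : ∀ n, x.coeff n = y.coeff n) : x = y :=
  SkewMonoidAlgebra.ext (k := R) (G := Multiplicative ℤ) fun n => h (Multiplicative.toAdd n)

theorem coeff_add (x y : TwistedLaurent R ν) (n : ℤ) :
    (x + y).coeff n = x.coeff n + y.coeff n :=
  DFunLike.congr_fun (SkewMonoidAlgebra.coeff_add (k := R) (G := Multiplicative ℤ) x y)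
    (Multiplicative.ofAdd n)

theorem coeff_sum {α : Type*} (s : Finset α) (x : α → TwistedLaurent R ν) (n : ℤ) :
    (∑ k ∈ s, x k).coeff n = ∑ k ∈ s, (x k).coeff n :=
  map_sum (AddMonoidHom.mk' (fun x : TwistedLaurent R ν => x.coeff n)
    fun x y => coeff_add x y n) x s

theorem coeff_monomial (k n : ℤ) (a : R) :
    (monomial k a : TwistedLaurent R ν).coeff n = if k = n then a else 0 :=
  SkewMonoidAlgebra.coeff_single_apply

theorem coeff_mul_monomial (x : TwistedLaurent R ν) (k n : ℤ) (a : R) :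
    (x * monomial k a).coeff n = x.coeff (n - k) * ν (Multiplicative.ofAdd (n - k)) a :=
  letI : MulSemiringAction (Multiplicative ℤ) R := MulSemiringAction.compHom R ν
  SkewMonoidAlgebra.coeff_mul_single (k := R) (G := Multiplicative ℤ) x a
    (Multiplicative.ofAdd k) (Multiplicative.ofAdd n)

theorem apply_apply (m n : ℤ) (a : R) :
    ν (Multiplicative.ofAdd m) (ν (Multiplicative.ofAdd n) a)
      = ν (Multiplicative.ofAdd (m + n)) a := by
  rw [← RingAut.mul_apply, ← map_mul, ← ofAdd_add]

theorem apply_neg_apply (n : ℤ) (a : R) :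
    ν (Multiplicative.ofAdd n) (ν (Multiplicative.ofAdd (-n)) a) = a := by
  rw [apply_apply, add_neg_cancel, ofAdd_zero, map_one]
  rfl

theorem apply_initPure (x : TwistedLaurent R ν) :
    ν (Multiplicative.ofAdd x.initPower) x.initPure = x.coeff x.initPower :=
  apply_neg_apply _ _

theorem coeff_of_lt_initPower (x : TwistedLaurent R ν) {n : ℤ} (h : n < x.initPower) :
    x.coeff n = 0 := by
  by_contra hn
  have hmem := (mem_support x n).2 hn
  rw [initPower, dif_pos ⟨n, hmem⟩] at h
  exact absurd (Finset.min'_le _ _ hmem) (not_le.2 h)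

theorem exists_degree_bound (x : TwistedLaurent R ν) :
    ∃ d : ℕ, ∀ n, x.initPower + d < n → x.coeff n = 0 := by
  obtain ⟨b, hb⟩ := x.support.bddAbove
  refine ⟨(b - x.initPower).toNat, fun n hn => ?_⟩
  by_contra h
  have := hb ((mem_support x n).2 h)
  omega

/-- If the coefficients of `x` below `p` vanish, then either the one at `p` vanishes or `t^p` is
the initial power. -/
theorem leftCoeff_eq_zero_or_initPure_eq {x : TwistedLaurent R ν} {p : ℤ}
    (h : ∀ n < p, x.coeff n = 0) : x.leftCoeff p = 0 ∨ x.initPure = x.leftCoeff p := by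
  by_cases hp : x.coeff p = 0
  · left
    rw [leftCoeff, hp, map_zero]
  · right
    have hmem := (mem_support x p).2 hp
    have : x.initPower = p := by
      rw [initPower, dif_pos ⟨p, hmem⟩]
      refine le_antisymm (Finset.min'_le _ _ hmem) (Finset.le_min' _ _ _ fun n hn => ?_)
      by_contra! hlt
      exact (mem_support x n).1 hn (h n hlt)
    rw [initPure, this]

/-- The Laurent polynomial `∑ t^(p+j) c_j`. -/
def ofLeftCoeff {m : ℕ} (p : ℤ) (c : Fin m → R) : TwistedLaurent R ν :=
  ∑ j : Fin m, monomial (p + (j : ℕ)) (ν (Multiplicative.ofAdd (p + (j : ℕ))) (c j))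

theorem coeff_ofLeftCoeff_self {m : ℕ} (p : ℤ) (c : Fin m → R) (i : Fin m) :
    (ofLeftCoeff p c : TwistedLaurent R ν).coeff (p + (i : ℕ))
      = ν (Multiplicative.ofAdd (p + (i : ℕ))) (c i) := by
  rw [ofLeftCoeff, coeff_sum, Finset.sum_eq_single i]
  · rw [coeff_monomial, if_pos rfl]
  · intro j _ hj
    rw [coeff_monomial, if_neg]
    exact fun h => hj (Fin.ext (by omega))
  · simp

theorem leftCoeff_ofLeftCoeff_self {m : ℕ} (p : ℤ) (c : Fin m → R) (i : Fin m) :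
    (ofLeftCoeff p c : TwistedLaurent R ν).leftCoeff (p + (i : ℕ)) = c i := by
  rw [leftCoeff, coeff_ofLeftCoeff_self, apply_apply, neg_add_cancel, ofAdd_zero, map_one]
  rfl

theorem coeff_ofLeftCoeff_of_lt {m : ℕ} (p : ℤ) (c : Fin m → R) (i : Fin m)
    (hc : ∀ j < i, c j = 0) {n : ℤ} (hn : n < p + (i : ℕ)) :
    (ofLeftCoeff p c : TwistedLaurent R ν).coeff n = 0 := by
  rw [ofLeftCoeff, coeff_sum]
  refine Finset.sum_eq_zero fun j _ => ?_
  rw [coeff_monomial]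
  split_ifs with h
  · rw [hc j (Fin.lt_def.2 (by omega)), map_zero]
  · rfl

theorem coeff_mul_ofLeftCoeff {m : ℕ} (x : TwistedLaurent R ν) (p : ℤ) (c : Fin m → R) (n : ℤ) :
    (x * ofLeftCoeff p c).coeff n = ∑ j : Fin m, x.coeff (n - (p + (j : ℕ))) *
      ν (Multiplicative.ofAdd n) (c j) := by
  rw [ofLeftCoeff, Finset.mul_sum, coeff_sum]
  refine Finset.sum_congr rfl fun j _ => ?_
  rw [coeff_mul_monomial, apply_apply, sub_add_cancel]

/-- The shift by `-x.initPower` puts the product in degrees `0` to `m + d - 1`. The larger bound `e`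
lets two products share one window. -/
theorem coeff_mul_ofLeftCoeff_eq_zero {m d e : ℕ} (x : TwistedLaurent R ν)
    (hd : ∀ n, x.initPower + d < n → x.coeff n = 0) (hde : d ≤ e) {n : ℤ}
    (hn : n < 0 ∨ ((m + e : ℕ) : ℤ) ≤ n) (c : Fin m → R) :
    (x * ofLeftCoeff (-x.initPower) c).coeff n = 0 := by
  rw [coeff_mul_ofLeftCoeff]
  refine Finset.sum_eq_zero fun j _ => ?_
  have hx : x.coeff (n - (-x.initPower + (j : ℕ))) = 0 := by
    rcases hn with hn | hn
    · exact coeff_of_lt_initPower x (by omega)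
    · exact hd _ (by omega)
  rw [hx, zero_mul]

end TwistedLaurent

/-! ### The approximate Ore condition. -/

theorem dimKer_conjTwist {G : Type*} [Group G] (K : Subgroup G) [K.Normal] (t : G)
    (z : Multiplicative ℤ) (x : groupVN K) : dimKer (conjTwist K t z x) = dimKer x :=
  dimKer_groupVNAut _ x

theorem dimKer_le_dimKer_mul {Γ : Type*} [Group Γ] (a b : groupVN Γ) :
    dimKer b ≤ dimKer (a * b) := by
  refine dimKer_mono fun x hx => ?_
  rw [LinearMap.mem_ker, ContinuousLinearMap.coe_coe] at hx
  rw [LinearMap.mem_ker, ContinuousLinearMap.coe_coe]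
  change (a : EllTwo Γ →L[ℂ] EllTwo Γ) ((b : EllTwo Γ →L[ℂ] EllTwo Γ) x) = 0
  rw [hx, map_zero]

theorem nul_ofLeftCoeff_le {G : Type*} [Group G] {K : Subgroup G} [K.Normal] {t : G} {m : ℕ}
    (p : ℤ) (c : Fin m → groupVN K) (i : Fin m) (hc : ∀ j < i, c j = 0) :
    nul (TwistedLaurent.ofLeftCoeff p c : VNLaurent K t) ≤ dimKer (c i) := by
  have h := TwistedLaurent.leftCoeff_eq_zero_or_initPure_eq (ν := conjTwist K t)
    (fun n hn => TwistedLaurent.coeff_ofLeftCoeff_of_lt p c i hc hn)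
  rw [TwistedLaurent.leftCoeff_ofLeftCoeff_self] at h
  rcases h with h | h
  · rw [h, dimKer_zero]
    exact dimKer_le_one _
  · rw [nul, h]

theorem sum_mul_eq_of_triangular {S : Type*} [Ring S] {m : ℕ} {a b : Fin m → S} (i : Fin m)
    (ha : ∀ j, i < j → a j = 0) (hb : ∀ j < i, b j = 0) :
    ∑ j, a j * b j = a i * b i := by
  refine Finset.sum_eq_single i (fun j _ hj => ?_) (by simp)
  rcases lt_or_gt_of_ne hj with h | h
  · rw [hb j h, mul_zero]
  · rw [ha j h, zero_mul]

/-- Multiplication by `x` in terms of left coefficients, as a triangular system. -/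
theorem exists_triangular {G : Type*} [Group G] (K : Subgroup G) [K.Normal] (t : G) (m : ℕ) :
    ∃ A : VNLaurent K t → ℕ → Fin m → groupVN K,
      (∀ x (c j : Fin m), c < j → A x c j = 0) ∧ (∀ x (j : Fin m), dimKer (A x j j) = nul x) ∧
      ∀ (x : VNLaurent K t) (c : ℕ) (R : Fin m → groupVN K),
        (x * TwistedLaurent.ofLeftCoeff (-x.initPower) R).coeff c
          = conjTwist K t (Multiplicative.ofAdd (c : ℤ)) (∑ j, A x c j * R j) := by
  refine ⟨fun x c j => conjTwist K t (Multiplicative.ofAdd (-(c : ℤ)))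
    (x.coeff (c - (-x.initPower + (j : ℕ)))), fun x c j hj => ?_, fun x j => ?_, fun x c R => ?_⟩
  · beta_reduce
    rw [TwistedLaurent.coeff_of_lt_initPower x (by omega), map_zero]
  · beta_reduce
    rw [dimKer_conjTwist, show ((j : ℕ) : ℤ) - (-x.initPower + (j : ℕ)) = x.initPower by ring,
      ← TwistedLaurent.apply_initPure, dimKer_conjTwist, nul]
  · rw [TwistedLaurent.coeff_mul_ofLeftCoeff, map_sum]
    refine Finset.sum_congr rfl fun j _ => ?_
    rw [map_mul, TwistedLaurent.apply_neg_apply]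

/-- The approximate Ore condition for any normal subgroup `K` and any `t`. -/
theorem approximate_ore {G : Type*} [Group G] (K : Subgroup G) [K.Normal] (t : G)
    (q q' : VNLaurent K t) (ε : ℝ) (hε : 0 < ε) :
    ∃ r r' : VNLaurent K t,
      nul r < nul q' + ε ∧ nul r' < nul q + nul q' + ε ∧ q * r = q' * r' := by
  obtain ⟨d₁, hd₁⟩ := q.exists_degree_bound
  obtain ⟨d₂, hd₂⟩ := q'.exists_degree_bound
  obtain ⟨m, hm⟩ := exists_nat_gt (((d₁ + d₂ : ℕ) : ℝ) / ε)
  rw [div_lt_iff₀ hε] at hm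
  obtain ⟨A, hA, hdiag, hmul⟩ := exists_triangular K t m
  obtain ⟨i, R, R', hRR, heq, hR⟩ := exists_solution_triangular m (d₁ + d₂) (A q) (A q') (hA q)
    (hA q') (nul q') ε (hdiag q') hm
  have hr := nul_ofLeftCoeff_le (t := t) (-q.initPower) R i fun j hj => (hRR j hj).1
  have hr' := nul_ofLeftCoeff_le (t := t) (-q'.initPower) R' i fun j hj => (hRR j hj).2
  have hi : A q i i * R i = A q' i i * R' i := by
    have h := heq i (by omega)
    rwa [sum_mul_eq_of_triangular i (hA q i) fun j hj => (hRR j hj).1,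
      sum_mul_eq_of_triangular i (hA q' i) fun j hj => (hRR j hj).2] at h
  -- Left multiplication by `A' i i` can only enlarge the kernel of `R' i`, and the product equals
  -- `A i i * R i`.
  have hR' : dimKer (R' i) ≤ nul q + dimKer (R i) := by
    have h1 := dimKer_le_dimKer_mul (A q' i i) (R' i)
    have h2 := dimKer_mul_le (A q i i) (R i)
    rw [← hi] at h1
    rw [hdiag q i] at h2
    exact h1.trans h2
  refine ⟨TwistedLaurent.ofLeftCoeff (-q.initPower) R,
    TwistedLaurent.ofLeftCoeff (-q'.initPower) R',
    hr.trans_lt hR, hr'.trans_lt (by linarith), TwistedLaurent.ext_coeff fun n => ?_⟩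
  by_cases hn : n < 0 ∨ ((m + (d₁ + d₂) : ℕ) : ℤ) ≤ n
  · rw [q.coeff_mul_ofLeftCoeff_eq_zero hd₁ (Nat.le_add_right _ _) hn,
      q'.coeff_mul_ofLeftCoeff_eq_zero hd₂ (Nat.le_add_left _ _) hn]
  · push Not at hn
    obtain ⟨h0, h1⟩ := hn
    lift n to ℕ using h0 with c
    rw [hmul, hmul, heq c (Int.ofNat_lt.1 h1)]

end

theorem mainTheorem12 {G : Type*} [Group G] (φ : G →* Multiplicative ℤ)
    (hφ : Function.Surjective φ) (t : G) (ht : Subgroup.zpowers (φ t) = φ.range)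
    (q q' : VNLaurent φ.ker t) (ε : ℝ) (hε : 0 < ε) :
    ∃ r r' : VNLaurent φ.ker t,
      nul r < nul q' + ε ∧ nul r' < nul q + nul q' + ε ∧ q * r = q' * r' :=
  approximate_ore φ.ker t q q' ε hε
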